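/- Let $J$ be an ideal on $\omega$, i.e. a family of subsets of $\omega$ that is closed under subsets and finite unions, contains all finite subsets of $\omega$, and does not contain $\omega$. Let $\mu$ be the (completed) product measure of the fair coin measures on the Cantor space $2^\omega$, let $\mathcal N$ be the family of $\mu$-null subsets of $2^\omega$, $\mathcal M$ the family of meager subsets of $2^\omega$, and $\mathcal E$ the $\sigma$-ideal generated by the closed $\mu$-null sets. Let $\overline\Omega$ be the set of all sequences $\bar c=\langle c_n:n\in\omega\rangle$ of clopen subsets of $2^\omega$ such that $\{x\in 2^\omega : x\in c_n\text{ for infinitely many }n\}$ is $\mu$-null. Let $\mathcal N_J$ be the family of all $X\subseteq 2^\omega$ for which there is $\bar c\in\overline\Omega$ such that $\{n\in\omega : x\in c_n\}\notin J$ for all $x\in X$, and let $\mathcal N^*_J$ be the family of all $X\subseteq 2^\omega$ for which there is $\bar c\in\overline\Omega$ such that $\{n\in\omega : x\notin c_n\}\in J$ for all $x\in X$. Then the following statements are equivalent: (i) $J$ does not have the Baire property as a subset of $\mathcal P(\omega)$, identified with $2^\omega$ through characteristic functions; (ii) $\mathcal N_J\subsetneq\mathcal N$; (iii) $\mathcal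 E\subsetneq\mathcal N^*_J$; (iv) no member of $\mathcal N_J$ is co-meager in $2^\omega$; (v) $\mathcal M\cap\mathcal N\nsubseteq\mathcal N_J$; (vi) $\mathcal N^*_J\nsubseteq\mathcal M$. -/

import Mathlib

namespace NullModIdeal

open MeasureTheory

/-- The Cantor space `2^ω`, with the product topology and product σ-algebra. -/
abbrev Cantor : Type := ℕ → Bool

/-- The Lebesgue measure on the Cantor space: the product of the fair coin measures. Applied to
an arbitrary set it is the outer measure, so "null" means null for the completion. -/
noncomputable def lebesgue : Measure Cantor :=
  Measure.infinitePi (fun _ : ℕ => (PMF.uniformOfFintype Bool).toMeasure)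

/-- Ideals on `ω`: hereditary, closed under finite unions, containing all finite sets, and
not containing `ω` itself. -/
structure IsIdealOnNat (J : Set (Set ℕ)) : Prop where
  mem_of_subset : ∀ a b : Set ℕ, a ⊆ b → b ∈ J → a ∈ J
  union_mem : ∀ a b : Set ℕ, a ∈ J → b ∈ J → a ∪ b ∈ J
  finite_mem : ∀ a : Set ℕ, a.Finite → a ∈ J
  univ_notMem : Set.univ ∉ J

/-- A family of subsets of `ω` has the Baire property in the power set of `ω`, which is identified
with the Cantor space through characteristic functions. -/
def HasBaireProperty (J : Set (Set ℕ)) : Prop :=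
  BaireMeasurableSet {χ : Cantor | {n : ℕ | χ n = true} ∈ J}

/-- `J⁺`, the sets not in `J`. -/
def positive (J : Set (Set ℕ)) : Set (Set ℕ) := {a | a ∉ J}

/-- `Jᵈ`, the sets whose complement is in `J`. -/
def dual (J : Set (Set ℕ)) : Set (Set ℕ) := {a | aᶜ ∈ J}

/-- The ideal of Lebesgue null subsets of the Cantor space. -/
def nullIdeal : Set (Set Cantor) := {X | lebesgue X = 0}

/-- The ideal of meager subsets of the Cantor space. -/
def meagerIdeal : Set (Set Cantor) := {X | IsMeagre X}

/-- The σ-ideal generated by the closed null subsets of the Cantor space. -/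
def closedNullIdeal : Set (Set Cantor) :=
  {X | ∃ F : ℕ → Set Cantor, (∀ n, IsClosed (F n) ∧ lebesgue (F n) = 0) ∧ X ⊆ ⋃ n, F n}

/-- Sequences of clopen sets such that the set of points lying in infinitely many of the terms
is null. -/
def OmegaBar : Set (ℕ → Set Cantor) :=
  {c | (∀ n, IsClopen (c n)) ∧ {x | {n | x ∈ c n}.Infinite} ∈ nullIdeal}

/-- `N_J(c)`. -/
def limsupMod (J : Set (Set ℕ)) (c : ℕ → Set Cantor) : Set Cantor :=
  {x | {n | x ∈ c n} ∈ positive J}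

/-- `N*_J(c)`. -/
def liminfMod (J : Set (Set ℕ)) (c : ℕ → Set Cantor) : Set Cantor :=
  {x | {n | x ∈ c n} ∈ dual J}

/-- `𝒩_J`: the sets that are null modulo `J`. -/
def nullMod (J : Set (Set ℕ)) : Set (Set Cantor) :=
  {X | ∃ c ∈ OmegaBar, X ⊆ limsupMod J c}

/-- `𝒩*_J`. -/
def nullStarMod (J : Set (Set ℕ)) : Set (Set Cantor) :=
  {X | ∃ c ∈ OmegaBar, X ⊆ liminfMod J c}

end NullModIdeal

open NullModIdeal

namespace NullModIdeal

open MeasureTheory hiding cylinder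
open Filter Topology PiNat
open scoped ENNReal

/-! Everything rests on the Jalali-Naini–Talagrand dichotomy: an ideal with the Baire property
admits consecutive finite intervals such that no member of `J` contains infinitely many of them,
while if `J` lacks the property, every such interval sequence has infinitely many intervals inside a
single member of `J`.

In the first case, repeating `c k` along the `k`-th interval turns an ordinary upper limit into one
modulo `J`, and uniting the `c n` over each interval bounds a lower limit modulo `J` by countably
many closed null sets. So `𝒩_J` is the null ideal and `𝒩*_J` is `ℰ ⊆ ℳ`; as a comeager null set
exists, (ii)–(vi) all fail.

In the second case, `exists_mem_iInter_of_not_hasBaireProperty` is a fusion argument: the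
construction enters open sets while the indices run through intervals swallowed by some `a ∈ J`, and
in the gaps it copies points that avoid the relevant `c n`. The limit `x` is generic, yet `{n | x ∈
c n} ∈ J`. Taking the whole space, a nowhere dense set of locally positive measure, and the
complements of `zeroBlock` yields (iv), (v) and (vi); (ii) and (iii) follow. -/

/-! ### Cylinders, compactness and category in the Cantor space. -/

theorem exists_cylinder_subset {U : Set Cantor} (hU : IsOpen U) {x : Cantor} (hx : x ∈ U) :
    ∃ n, cylinder x n ⊆ U := by
  obtain ⟨s, ⟨y, n, rfl⟩, hxs, hs⟩ :=
    (isTopologicalBasis_cylinders (fun _ : ℕ => Bool)).mem_nhds_iff.1 (hU.mem_nhds hx)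
  exact ⟨n, by rwa [mem_cylinder_iff_eq.1 hxs]⟩

theorem dense_of_forall_cylinder {S : Set Cantor} (h : ∀ x n, ∃ y ∈ cylinder x n, y ∈ S) :
    Dense S := by
  refine dense_iff_inter_open.2 fun U hU ⟨x, hx⟩ => ?_
  obtain ⟨n, hn⟩ := exists_cylinder_subset hU hx
  obtain ⟨y, hy, hyS⟩ := h x n
  exact ⟨y, hn hy, hyS⟩

/-- Membership in a clopen set depends on finitely many coordinates only. -/
theorem exists_clopen_bound {C : Set Cantor} (hC : IsClopen C) :
    ∃ N : ℕ, ∀ n ≥ N, ∀ x, ∀ y ∈ cylinder x n, y ∈ C ↔ x ∈ C := by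
  have h : ∀ x, ∃ n, ∀ y ∈ cylinder x n, y ∈ C ↔ x ∈ C := by
    intro x
    by_cases hx : x ∈ C
    · obtain ⟨n, hn⟩ := exists_cylinder_subset hC.isOpen hx
      exact ⟨n, fun y hy => iff_of_true (hn hy) hx⟩
    · obtain ⟨n, hn⟩ := exists_cylinder_subset hC.compl.isOpen hx
      exact ⟨n, fun y hy => iff_of_false (hn hy) hx⟩
  choose f hf using h
  obtain ⟨t, ht⟩ := isCompact_univ.elim_finite_subcover (fun x : Cantor => cylinder x (f x))
    (fun x => isOpen_cylinder _ x _) (fun x _ => Set.mem_iUnion.2 ⟨x, self_mem_cylinder x _⟩)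
  refine ⟨t.sup f, fun n hn x y hy => ?_⟩
  obtain ⟨z, hz, hxz⟩ := Set.mem_iUnion₂.1 (ht (Set.mem_univ x))
  have hyz : y ∈ cylinder z (f z) := by
    rw [← mem_cylinder_iff_eq.1 hxz]
    exact cylinder_anti x ((Finset.le_sup hz).trans hn) hy
  rw [hf z y hyz, hf z x hxz]

/-- Only finitely many cylinders of a given length exist, so a bound depending on a point can be
made uniform. -/
theorem exists_uniform_bound {P : Set Cantor} (n : ℕ) {R : Cantor → ℕ → Prop}
    (hR : ∀ z, Monotone (R z)) (h : ∀ p ∈ P, ∃ z ∈ P, z ∈ cylinder p n ∧ ∃ N, R z N) :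
    ∃ N, ∀ p ∈ P, ∃ z ∈ P, z ∈ cylinder p n ∧ R z N := by
  have key : ∀ s : Fin n → Bool, ∃ N, ∀ p ∈ P, (fun i : Fin n => p i) = s →
      ∃ z ∈ P, z ∈ cylinder p n ∧ R z N := by
    intro s
    by_cases hs : ∃ p ∈ P, (fun i : Fin n => p i) = s
    · obtain ⟨p, hp, rfl⟩ := hs
      obtain ⟨z, hzP, hz, N, hN⟩ := h p hp
      refine ⟨N, fun q _ hqp => ⟨z, hzP, fun i hi => ?_, hN⟩⟩
      rw [hz i hi]
      exact (congrFun hqp ⟨i, hi⟩).symm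
    · exact ⟨0, fun p hp hps => (hs ⟨p, hp, hps⟩).elim⟩
  choose N hN using key
  refine ⟨Finset.univ.sup N, fun p hp => ?_⟩
  obtain ⟨z, hzP, hz, hRz⟩ := hN _ p hp rfl
  exact ⟨z, hzP, hz, hR z (Finset.le_sup (Finset.mem_univ _)) hRz⟩

theorem exists_antitone_open_of_mem_residual {Z : Set Cantor} (hZ : Z ∈ residual Cantor) :
    ∃ D : ℕ → Set Cantor, (∀ n, IsOpen (D n)) ∧ (∀ n, Dense (D n)) ∧ Antitone D ∧
      ⋂ n, D n ⊆ Z := by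
  obtain ⟨t, htZ, ht, htd⟩ := mem_residual.1 hZ
  obtain ⟨f, hf, rfl⟩ := isGδ_iff_eq_iInter_nat.1 ht
  refine ⟨fun k => ⋂ j ≤ k, f j, fun k => (Set.finite_le_nat k).isOpen_biInter fun j _ => hf j,
    fun k => htd.mono fun x hx => ?_, fun k l hkl x hx => ?_, fun x hx => htZ ?_⟩
  · simp only [Set.mem_iInter] at hx ⊢
    exact fun j _ => hx j
  · simp only [Set.mem_iInter] at hx ⊢
    exact fun j hj => hx j (hj.trans hkl)
  · simp only [Set.mem_iInter] at hx ⊢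
    exact fun j => hx j j le_rfl

/-! ### Null sets and sequences in `OmegaBar`. -/

instance : IsProbabilityMeasure lebesgue := by
  unfold lebesgue; infer_instance

theorem lebesgue_pi_singleton (s : Finset ℕ) (x : Cantor) :
    lebesgue ((s : Set ℕ).pi fun i => {x i}) = 2⁻¹ ^ s.card := by
  rw [lebesgue, Measure.infinitePi_pi _ (fun i _ => MeasurableSet.singleton _)]
  simp

theorem lebesgue_cylinder (x : Cantor) (n : ℕ) : lebesgue (cylinder x n) = 2⁻¹ ^ n := by
  rw [cylinder_eq_pi, lebesgue_pi_singleton, Finset.card_range]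

instance : lebesgue.IsOpenPosMeasure where
  open_pos U hU := by
    rintro ⟨x, hx⟩ h0
    obtain ⟨n, hn⟩ := exists_cylinder_subset hU hx
    have := measure_mono_null hn h0
    rw [lebesgue_cylinder] at this
    simp at this

instance : NullSingletonClass lebesgue where
  measure_singleton x := by
    refine le_antisymm (ge_of_tendsto' (x := atTop)
      (ENNReal.tendsto_pow_atTop_nhds_zero_of_lt_one (r := 2⁻¹) (by simp)) fun n => ?_) zero_le
    rw [← lebesgue_cylinder x n]
    exact measure_mono (Set.singleton_subset_iff.2 (self_mem_cylinder x n))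

theorem tsum_inv_two_pow_ne_top : ∑' n : ℕ, (2⁻¹ : ℝ≥0∞) ^ n ≠ ∞ := by
  rw [ENNReal.tsum_geometric_two]; simp

theorem exists_open_superset_lt {X : Set Cantor} (hX : lebesgue X = 0) (n : ℕ) :
    ∃ U ⊇ X, IsOpen U ∧ lebesgue U < 2⁻¹ ^ n :=
  Set.exists_isOpen_lt_of_lt X _ (by rw [hX]; exact ENNReal.pow_pos (by simp) n)

theorem exists_antitone_open_superset {X : Set Cantor} (hX : lebesgue X = 0) :
    ∃ V : ℕ → Set Cantor, (∀ n, IsOpen (V n)) ∧ Antitone V ∧ (∀ n, X ⊆ V n) ∧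
      ∀ n, lebesgue (V n) < 2⁻¹ ^ n := by
  choose U hXU hU hlt using exists_open_superset_lt hX
  refine ⟨fun k => ⋂ j ≤ k, U j, fun k => (Set.finite_le_nat k).isOpen_biInter fun j _ => hU j,
    fun k l hkl x hx => ?_, fun k x hx => ?_, fun k => (measure_mono fun x hx => ?_).trans_lt (hlt k)⟩
  · simp only [Set.mem_iInter] at hx ⊢
    exact fun j hj => hx j (hj.trans hkl)
  · simp only [Set.mem_iInter]
    exact fun j _ => hXU j hx
  · simp only [Set.mem_iInter] at hx
    exact hx k le_rfl

theorem lebesgue_iInter_eq_zero {V : ℕ → Set Cantor} (hV : ∀ n, lebesgue (V n) < 2⁻¹ ^ n) :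
    lebesgue (⋂ n, V n) = 0 :=
  le_antisymm (ge_of_tendsto' (x := atTop)
    (ENNReal.tendsto_pow_atTop_nhds_zero_of_lt_one (r := 2⁻¹) (by simp)) fun n =>
    (measure_mono (Set.iInter_subset V n)).trans (hV n).le) zero_le

theorem mem_OmegaBar_of_tsum {c : ℕ → Set Cantor} (hc : ∀ n, IsClopen (c n))
    (hs : ∑' n, lebesgue (c n) ≠ ∞) : c ∈ OmegaBar := by
  refine ⟨hc, ?_⟩
  have := measure_setOfPred_frequently_eq_zero (μ := lebesgue) (p := fun n x => x ∈ c n) hs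
  change lebesgue _ = 0
  simpa only [Nat.frequently_atTop_iff_infinite] using this

/-- Disjointness makes the measures of the pieces add up to that of `U`, as Borel–Cantelli needs
later. -/
theorem exists_disjoint_clopen_iUnion {U : Set Cantor} (hU : IsOpen U) :
    ∃ f : ℕ → Set Cantor, (∀ n, IsClopen (f n)) ∧ Pairwise (Function.onFun Disjoint f) ∧
      ⋃ n, f n = U := by
  let _ := TopologicalSpace.metrizableSpaceMetric Cantor
  obtain ⟨F, hF, hFU, hUF, -⟩ := hU.exists_iUnion_isClosed
  choose C hC hFC hCU using fun n => exists_clopen_of_closed_subset_open (hF n) hU (hFU n)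
  refine ⟨disjointed C, fun n => ?_, disjoint_disjointed C, ?_⟩
  · exact disjointedRec (p := fun s => IsClopen s) (fun t i ht => ht.diff (hC i)) (hC n)
  · rw [iUnion_disjointed]
    exact (Set.iUnion_subset hCU).antisymm (hUF ▸ Set.iUnion_mono hFC)

/-- Every null set is contained in the upper limit of some `c ∈ OmegaBar`. -/
theorem exists_OmegaBar_infinite {X : Set Cantor} (hX : X ∈ nullIdeal) :
    ∃ c ∈ OmegaBar, ∀ x ∈ X, {n | x ∈ c n}.Infinite := by
  obtain ⟨V, hV, -, hXV, hlt⟩ := exists_antitone_open_superset hX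
  choose f hf hd hfV using fun n => exists_disjoint_clopen_iUnion (hV n)
  refine ⟨fun n => f n.unpair.1 n.unpair.2, mem_OmegaBar_of_tsum (fun n => hf _ _) ?_, ?_⟩
  · have h1 : ∑' n : ℕ, lebesgue (f n.unpair.1 n.unpair.2)
        = ∑' p : ℕ × ℕ, lebesgue (f p.1 p.2) :=
      Nat.pairEquiv.symm.tsum_eq fun p : ℕ × ℕ => lebesgue (f p.1 p.2)
    rw [h1, ENNReal.tsum_prod (f := fun n i => lebesgue (f n i))]
    refine ne_top_of_le_ne_top tsum_inv_two_pow_ne_top (ENNReal.tsum_le_tsum fun n => ?_)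
    rw [← measure_iUnion (hd n) fun i => (hf n i).isOpen.measurableSet, hfV]
    exact (hlt n).le
  · intro x hx
    have : ∀ n, ∃ i, x ∈ f n i := fun n => Set.mem_iUnion.1 (hfV n ▸ hXV n hx)
    choose i hi using this
    refine Set.infinite_of_injective_forall_mem (f := fun n => Nat.pair n (i n)) ?_ ?_
    · intro n n' h
      exact (Nat.pair_eq_pair.1 h).1
    · intro n
      simpa using hi n

/-- Every set in the σ-ideal generated by closed null sets is contained in the lower limit of some
`c ∈ OmegaBar`. -/
theorem exists_OmegaBar_eventually {X : Set Cantor} (hX : X ∈ closedNullIdeal) :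
    ∃ c ∈ OmegaBar, ∀ x ∈ X, {n | x ∉ c n}.Finite := by
  obtain ⟨F, hF, hXF⟩ := hX
  have h : ∀ n, ∃ C : Set Cantor, IsClopen C ∧ (∀ j ≤ n, F j ⊆ C) ∧ lebesgue C ≤ 2⁻¹ ^ n := by
    intro n
    have h0 : lebesgue (⋃ j ≤ n, F j) = 0 :=
      (measure_biUnion_null_iff (Set.to_countable _)).2 fun j _ => (hF j).2
    have hcl : IsClosed (⋃ j ≤ n, F j) :=
      (Set.finite_le_nat n).isClosed_biUnion fun j _ => (hF j).1
    obtain ⟨U, hU, hUo, hlt⟩ := exists_open_superset_lt h0 n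
    obtain ⟨C, hC, hFC, hCU⟩ := exists_clopen_of_closed_subset_open hcl hUo hU
    exact ⟨C, hC, fun j hj => (Set.subset_biUnion_of_mem (s := {j | j ≤ n}) (u := F) hj).trans hFC,
      (measure_mono hCU).trans hlt.le⟩
  choose c hc hFc hle using h
  refine ⟨c, mem_OmegaBar_of_tsum hc
    (ne_top_of_le_ne_top tsum_inv_two_pow_ne_top (ENNReal.tsum_le_tsum hle)), fun x hx => ?_⟩
  obtain ⟨j, hj⟩ := Set.mem_iUnion.1 (hXF hx)
  refine (Set.finite_lt_nat j).subset fun n hn => ?_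
  by_contra hjn
  exact hn (hFc n j (not_lt.1 hjn) hj)

theorem closedNullIdeal_subset_meagerIdeal : closedNullIdeal ⊆ meagerIdeal := by
  rintro X ⟨F, hF, hXF⟩
  refine IsMeagre.mono hXF (isMeagre_iUnion fun n => IsNowhereDense.isMeagre ?_)
  exact (hF n).1.isNowhereDense_iff.2 (Measure.interior_eq_empty_of_null (hF n).2)

/-- There is a nonempty closed nowhere dense set all of whose nonempty relatively open subsets
have positive measure. -/
theorem exists_nowhereDense_selfSupporting :
    ∃ P : Set Cantor, IsClosed P ∧ P.Nonempty ∧ IsNowhereDense P ∧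
      ∀ U, IsOpen U → (P ∩ U).Nonempty → 0 < lebesgue (P ∩ U) := by
  obtain ⟨Q, hQ, hQd⟩ := TopologicalSpace.exists_countable_dense Cantor
  -- `V` is dense open of measure below 1/2, so its complement is nowhere dense and not null.
  -- Passing to the support of the restricted measure discards the locally null part.
  obtain ⟨V, hQV, hV, hlt⟩ := exists_open_superset_lt (hQ.measure_zero lebesgue) 1
  have hpos : lebesgue Vᶜ ≠ 0 := by
    intro h
    rw [prob_compl_eq_zero_iff hV.measurableSet] at h
    rw [h] at hlt
    simp at hlt
  set ν := lebesgue.restrict Vᶜ with hν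
  have hPV : ν.support ⊆ Vᶜ :=
    fun x hx => hV.isClosed_compl.closure_eq ▸ (Measure.support_restrict_subset hx).1
  refine ⟨ν.support, Measure.isClosed_support, Measure.nonempty_support ?_, ?_, ?_⟩
  · rw [hν, Ne, Measure.restrict_eq_zero]
    exact hpos
  · rw [Measure.isClosed_support.isNowhereDense_iff, ← Set.compl_univ_iff, ← closure_compl]
    exact ((hQd.mono hQV).mono (Set.subset_compl_comm.1 hPV)).closure_eq
  · rintro U hU ⟨x, hx, hxU⟩
    have h1 : 0 < ν U := (Measure.mem_support_iff_forall x).1 hx U (hU.mem_nhds hxU)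
    have h2 : ν (ν.support ∩ U) = ν U := by
      rw [Set.inter_comm]
      exact measure_inter_conull Measure.measure_compl_support
    rw [← h2] at h1
    exact h1.trans_le (Measure.restrict_apply_le _ _)

/-! ### The Jalali-Naini–Talagrand dichotomy. -/

variable {J : Set (Set ℕ)}

/-- Coordinatewise exclusive disjunction with `g`. -/
def flipBits (g : Cantor) : Cantor ≃ₜ Cantor where
  toFun x := fun i => xor (g i) (x i)
  invFun x := fun i => xor (g i) (x i)
  left_inv x := by ext i; simp
  right_inv x := by ext i; simp
  continuous_toFun := continuous_pi fun i =>
    (continuous_of_discreteTopology (f := fun b => xor (g i) b)).comp (continuous_apply i)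
  continuous_invFun := continuous_pi fun i =>
    (continuous_of_discreteTopology (f := fun b => xor (g i) b)).comp (continuous_apply i)

theorem flipBits_apply (g x : Cantor) (i : ℕ) : flipBits g x i = xor (g i) (x i) := rfl

theorem flipBits_preimage_mem_residual (g : Cantor) {S : Set Cantor} (hS : S ∈ residual Cantor) :
    flipBits g ⁻¹' S ∈ residual Cantor :=
  tendsto_residual_of_isOpenMap (flipBits g).continuous (flipBits g).isOpenMap hS

/-- An ideal with the Baire property is meager. -/
theorem isMeagre_of_hasBaireProperty (hJ : IsIdealOnNat J) (hB : HasBaireProperty J) :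
    IsMeagre {χ : Cantor | {n : ℕ | χ n = true} ∈ J} := by
  obtain ⟨U, hU, hSU⟩ := BaireMeasurableSet.residualEq_isOpen hB
  have hres : {x : Cantor | {n : ℕ | x n = true} ∈ J ↔ x ∈ U} ∈ residual Cantor :=
    hSU.mono fun x hx => Iff.of_eq hx
  rcases U.eq_empty_or_nonempty with rfl | ⟨x, hx⟩
  · refine mem_of_superset hres fun x hx => ?_
    exact fun h => (hx.1 h).elim
  · exfalso
    obtain ⟨n, hn⟩ := exists_cylinder_subset hU hx
    -- Flipping all coordinates from `n` on preserves the cylinder and complements a set up to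
    -- finitely many points, so a generic `z` gives two members of `J` with cofinite union.
    set g : Cantor := fun i => decide (n ≤ i) with hg
    obtain ⟨z, hz, hz1, hz2⟩ := (dense_of_mem_residual
      (inter_mem hres (flipBits_preimage_mem_residual g hres))).inter_open_nonempty
        (cylinder x n) (isOpen_cylinder _ x n) ⟨x, self_mem_cylinder x n⟩
    have hfz : flipBits g z ∈ cylinder x n := by
      intro i hi
      rw [flipBits_apply, ← hz i hi]
      simp [hg, not_le.2 hi]
    have h1 := hz1.2 (hn hz)
    have h2 := hz2.2 (hn hfz)
    refine hJ.univ_notMem (hJ.mem_of_subset _ _ ?_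
      (hJ.union_mem _ _ (hJ.union_mem _ _ h1 h2) (hJ.finite_mem _ (Set.finite_lt_nat n))))
    intro i _
    by_cases hi : i < n
    · exact Or.inr hi
    · left
      by_cases hzi : z i = true
      · exact Or.inl hzi
      · right
        show flipBits g z i = true
        simp [flipBits_apply, hg, not_lt.1 hi, hzi]

/-- If an open set contains all finite modifications of `y`, then it contains all points agreeing
with `y` on a suitable finite block. -/
theorem exists_block_of_finite_modifications {U : Set Cantor} (hU : IsOpen U) {y : Cantor}
    (hy : ∀ z : Cantor, (∀ᶠ i in atTop, z i = y i) → z ∈ U) (m : ℕ) :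
    ∃ m' > m, ∀ x : Cantor, (∀ i ∈ Set.Ico m m', x i = y i) → x ∈ U := by
  obtain ⟨N, hN⟩ := exists_uniform_bound (P := {z | ∀ i ≥ m, z i = y i}) m
    (R := fun z N => cylinder z N ⊆ U)
    (fun z a b hab h => (cylinder_anti z hab).trans h) (fun p hp => ⟨p, hp, self_mem_cylinder p m,
      exists_cylinder_subset hU (hy p (eventually_atTop.2 ⟨m, hp⟩))⟩)
  refine ⟨max N (m + 1), by omega, fun x hx => ?_⟩
  obtain ⟨z, hz, hzx, hzU⟩ := hN (fun i => if i < m then x i else y i)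
    (fun i hi => if_neg (not_lt.2 hi))
  refine hzU fun i hi => ?_
  by_cases him : i < m
  · exact ((hzx i him).trans (if_pos him)).symm
  · rw [hz i (not_lt.1 him)]
    exact hx i ⟨not_lt.1 him, lt_max_of_lt_left hi⟩

/-- One half of the Jalali-Naini–Talagrand theorem. -/
theorem exists_blocks_of_hasBaireProperty (hJ : IsIdealOnNat J) (hB : HasBaireProperty J) :
    ∃ m : ℕ → ℕ, StrictMono m ∧
      ∀ a, (∃ᶠ k in atTop, Set.Ico (m k) (m (k + 1)) ⊆ a) → a ∉ J := by
  obtain ⟨D, hDo, hDd, hDa, hDJ⟩ :=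
    exists_antitone_open_of_mem_residual (isMeagre_of_hasBaireProperty hJ hB)
  have hres : ⋂ s : Finset ℕ, ⋂ k, flipBits (fun i => decide (i ∈ s)) ⁻¹' D k ∈ residual Cantor :=
    countable_iInter_mem.2 fun s => countable_iInter_mem.2 fun k =>
      flipBits_preimage_mem_residual _ (residual_of_dense_open (hDo k) (hDd k))
  obtain ⟨y, hy⟩ := (dense_of_mem_residual hres).nonempty
  simp only [Set.mem_iInter, Set.mem_preimage] at hy
  have hmod : ∀ k, ∀ z : Cantor, (∀ᶠ i in atTop, z i = y i) → z ∈ D k := by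
    intro k z hz
    obtain ⟨n, hn⟩ := eventually_atTop.1 hz
    convert hy ((Finset.range n).filter fun i => z i ≠ y i) k
    ext i
    rw [flipBits_apply]
    by_cases hi : z i = y i
    · simp [hi]
    · have : i < n := by
        by_contra h
        exact hi (hn i (not_lt.1 h))
      cases hzi : z i <;> cases hyi : y i <;> simp_all
  choose f hf hfD using fun k => exists_block_of_finite_modifications (hDo k) (hmod k)
  let m : ℕ → ℕ := fun k => Nat.rec 0 (fun k a => f k a) k
  refine ⟨m, strictMono_nat_of_lt_succ fun k => hf k (m k), fun a ha haJ => ?_⟩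
  classical
  -- `x` codes a subset of `a` and copies `y` on infinitely many blocks. This puts it in every `D
  -- k`, hence outside `J`.
  let x : Cantor := fun i => decide (i ∈ a) && y i
  have hx : x ∈ ⋂ k, D k := by
    refine Set.mem_iInter.2 fun k => ?_
    obtain ⟨l, hl, hla⟩ := (frequently_atTop.1 ha) k
    refine hDa hl (hfD l (m l) x fun i hi => ?_)
    have : i ∈ a := hla hi
    simp [x, this]
  refine hDJ hx (hJ.mem_of_subset _ _ (fun i hi => ?_) haJ)
  have : x i = true := hi
  simp only [x, Bool.and_eq_true, decide_eq_true_eq] at this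
  exact this.1

/-- The other half of the Jalali-Naini–Talagrand theorem. -/
theorem exists_mem_of_not_hasBaireProperty (hB : ¬ HasBaireProperty J)
    {m : ℕ → ℕ} (hm : StrictMono m) :
    ∃ a ∈ J, ∃ᶠ k in atTop, Set.Ico (m k) (m (k + 1)) ⊆ a := by
  by_contra! h
  refine hB (IsMeagre.baireMeasurableSet ?_)
  -- Containing infinitely many blocks is a comeager property; if every member of `J` fails it, `J`
  -- is meager.
  have hres : ⋂ N : ℕ, ⋃ k ≥ N, ⋂ i ∈ Set.Ico (m k) (m (k + 1)), {χ : Cantor | χ i = true}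
      ∈ residual Cantor := by
    refine countable_iInter_mem.2 fun N => residual_of_dense_open ?_ ?_
    · refine isOpen_biUnion fun k _ => (Set.finite_Ico _ _).isOpen_biInter fun i _ => ?_
      exact (isOpen_discrete ({true} : Set Bool)).preimage (continuous_apply (A := fun _ => Bool) i)
    · refine dense_of_forall_cylinder fun x n => ⟨fun i => if i < n then x i else true,
        fun i hi => if_pos hi, ?_⟩
      simp only [Set.mem_iUnion, Set.mem_iInter]
      refine ⟨max N n, le_max_left _ _, fun i hi => if_neg ?_⟩
      have := hm.le_apply (x := max N n)
      have := hi.1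
      omega
  refine mem_of_superset hres fun χ hχ hχJ => ?_
  obtain ⟨N, hN⟩ := eventually_atTop.1 (h _ hχJ)
  simp only [Set.mem_iInter, Set.mem_iUnion] at hχ
  obtain ⟨k, hk, hχk⟩ := hχ N
  exact hN k hk fun i hi => hχk i hi

/-! ### The fusion argument. -/

/-- A sequence of indices controlling the membership in the first clopen sets. -/
theorem exists_clopen_bounds {c : ℕ → Set Cantor} (hc : ∀ n, IsClopen (c n)) :
    ∃ b : ℕ → ℕ, Monotone b ∧ (∀ n, n ≤ b n) ∧
      ∀ j n, j < n → ∀ x, ∀ y ∈ cylinder x (b n), y ∈ c j ↔ x ∈ c j := by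
  choose N hN using fun n => exists_clopen_bound (hc n)
  refine ⟨fun n => n + (Finset.range n).sup N, fun k l hkl => ?_, fun n => Nat.le_add_right _ _,
    fun j n hj => hN j _ ?_⟩
  · exact add_le_add hkl (Finset.sup_mono (Finset.range_mono hkl))
  · exact (Finset.le_sup (f := N) (Finset.mem_range.2 hj)).trans (Nat.le_add_left _ _)

/-- If `J` does not have the Baire property and the points lying in finitely many `c n` are
suitably dense in the closed set `P`, then relatively comeager subsets of `P` contain points `x`
with `{n | x ∈ c n} ∈ J`. -/
theorem exists_mem_iInter_of_not_hasBaireProperty (hJ : IsIdealOnNat J)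
    (hB : ¬ HasBaireProperty J) {P : Set Cantor} (hP : IsClosed P) (hPn : P.Nonempty)
    {D : ℕ → Set Cantor} (hD : ∀ n, IsOpen (D n)) (hDa : Antitone D)
    {c : ℕ → Set Cantor} (hc : ∀ n, IsClopen (c n))
    (h : ∀ k n, ∀ p ∈ P, ∃ z ∈ P, z ∈ cylinder p n ∧ z ∈ D k ∧ {j | z ∈ c j}.Finite) :
    ∃ x ∈ P, (∀ k, x ∈ D k) ∧ {n | x ∈ c n} ∈ J := by
  obtain ⟨b, hbm, hbn, hb⟩ := exists_clopen_bounds hc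
  -- Preserving `b m` coordinates preserves all decisions about `c j` for `j < m`; only indices in
  -- `[m, m')` remain uncontrolled for `z`. Uniformity in `p` lets the intervals be fixed before `a`
  -- is known.
  have step : ∀ k m, ∃ m' > m, ∀ p ∈ P, ∃ z ∈ P, z ∈ cylinder p (b m) ∧
      (∀ j ≥ m', z ∉ c j) ∧ cylinder z (b m') ⊆ D k := by
    intro k m
    obtain ⟨N, hN⟩ := exists_uniform_bound (P := P) (b m)
      (R := fun z N => (∀ j ≥ N, z ∉ c j) ∧ cylinder z N ⊆ D k)
      (fun z a b hab h => ⟨fun j hj => h.1 j (hab.trans hj), (cylinder_anti z hab).trans h.2⟩)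
      (fun p hp => by
        obtain ⟨z, hzP, hz, hzD, hfin⟩ := h k (b m) p hp
        obtain ⟨n, hn⟩ := exists_cylinder_subset (hD k) hzD
        obtain ⟨l, hl⟩ := hfin.bddAbove
        refine ⟨z, hzP, hz, max n (l + 1), fun j hj hzj => ?_,
          (cylinder_anti z (le_max_left _ _)).trans hn⟩
        have : j ≤ l := hl hzj
        omega)
    refine ⟨max N (m + 1), by omega, fun p hp => ?_⟩
    obtain ⟨z, hzP, hz, hz1, hz2⟩ := hN p hp
    exact ⟨z, hzP, hz, fun j hj => hz1 j ((le_max_left _ _).trans hj),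
      (cylinder_anti z ((le_max_left _ _).trans (hbn _))).trans hz2⟩
  choose f hf hfz using step
  let m : ℕ → ℕ := fun k => Nat.rec 0 (fun k a => f k a) k
  have hm : StrictMono m := strictMono_nat_of_lt_succ fun k => hf k (m k)
  have hmz : ∀ k, ∀ p ∈ P, ∃ z ∈ P, z ∈ cylinder p (b (m k)) ∧
      (∀ j ≥ m (k + 1), z ∉ c j) ∧ cylinder z (b (m (k + 1))) ⊆ D k := fun k => hfz k (m k)
  obtain ⟨a, haJ, ha⟩ := exists_mem_of_not_hasBaireProperty hB hm
  obtain ⟨e, he, hea⟩ := extraction_of_frequently_atTop ha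
  choose! g hgP hgc hgj hgD using hmz
  obtain ⟨p, hp⟩ := hPn
  -- Corrections are made only at the blocks `e i` contained in `a`. Stage `i + 1` keeps the first
  -- `b (m (e (i + 1)))` coordinates, so the diagonal `x` below is the limit.
  let z : ℕ → Cantor := fun i => Nat.rec (g (e 0) p) (fun i q => g (e (i + 1)) q) i
  have hzs : ∀ i, z (i + 1) = g (e (i + 1)) (z i) := fun i => rfl
  have hzP : ∀ i, z i ∈ P := by
    intro i
    induction i with
    | zero => exact hgP _ _ hp
    | succ i ih => exact hgP _ _ ih
  have hzj : ∀ i, ∀ j ≥ m (e i + 1), z i ∉ c j := by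
    intro i
    cases i with
    | zero => exact hgj _ _ hp
    | succ i => exact hgj _ _ (hzP i)
  have hzD : ∀ i, cylinder (z i) (b (m (e i + 1))) ⊆ D (e i) := by
    intro i
    cases i with
    | zero => exact hgD _ _ hp
    | succ i => exact hgD _ _ (hzP i)
  have hme : StrictMono fun i => m (e i) := hm.comp he
  have hbme : Monotone fun i => b (m (e i)) := hbm.comp hme.monotone
  have hagree : ∀ i l, i ≤ l → z l ∈ cylinder (z i) (b (m (e (i + 1)))) := by
    intro i l hil
    induction l, hil using Nat.le_induction with
    | base => exact self_mem_cylinder _ _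
    | succ l hil ih =>
      intro t ht
      rw [← ih t ht, hzs]
      exact hgc _ _ (hzP l) t (ht.trans_le (hbme (Nat.succ_le_succ hil)))
  have hlt : ∀ i, i < b (m (e (i + 1))) := fun i =>
    (hme.le_apply (x := i + 1)).trans (hbn _)
  let x : Cantor := fun l => z l l
  have hx : ∀ i, x ∈ cylinder (z i) (b (m (e (i + 1)))) := by
    intro i t ht
    rcases le_total i t with hit | hti
    · exact hagree i t hit t ht
    · exact (hagree t i hti t (hlt t)).symm
  refine ⟨x, ?_, fun k => ?_, ?_⟩
  · refine hP.mem_of_tendsto (b := atTop) (f := z) (tendsto_pi_nhds.2 fun l => ?_)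
      (Eventually.of_forall hzP)
    refine tendsto_const_nhds.congr' ?_
    filter_upwards [eventually_ge_atTop l] with i hi
    exact (hagree l i hi l (hlt l)).symm
  · refine hDa (he.le_apply (x := k)) (hzD k ?_)
    exact cylinder_anti _ (hbm (hm.monotone (he (Nat.lt_succ_self k)))) (hx k)
  · refine hJ.mem_of_subset _ _ (fun j hj => ?_)
      (hJ.union_mem _ _ haJ (hJ.finite_mem _ (Set.finite_lt_nat (m (e 0)))))
    by_contra hcon
    rw [Set.mem_union, not_or, Set.mem_ofPred_eq, not_lt] at hcon
    obtain ⟨hja, hj0⟩ := hcon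
    obtain ⟨i, hi1, hi2⟩ : ∃ i, m (e i) ≤ j ∧ j < m (e (i + 1)) := by
      by_contra! hno
      have : ∀ i, m (e i) ≤ j := fun i => by
        induction i with
        | zero => exact hj0
        | succ i ih => exact hno i ih
      exact absurd (this (j + 1)) (not_le.2 (hme.le_apply (x := j + 1)))
    -- Outside `a`, `j` lies in the gap after block `e i`, where `z i` avoids `c j` and `x` agrees
    -- with `z i` far enough to avoid it too.
    have hji : m (e i + 1) ≤ j := by
      by_contra hlt
      exact hja (hea i ⟨hi1, not_le.1 hlt⟩)
    exact hzj i j hji ((hb j _ hi2 (z i) x (hx i)).1 hj)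

/-- The case of `c ∈ OmegaBar` and a closed set all of whose nonempty relatively open subsets
have positive measure. -/
theorem exists_mem_iInter_of_selfSupporting (hJ : IsIdealOnNat J)
    (hB : ¬ HasBaireProperty J) {P : Set Cantor} (hP : IsClosed P) (hPn : P.Nonempty)
    (hpos : ∀ U, IsOpen U → (P ∩ U).Nonempty → 0 < lebesgue (P ∩ U))
    {D : ℕ → Set Cantor} (hD : ∀ n, IsOpen (D n)) (hDa : Antitone D)
    (hDP : ∀ k, P ⊆ closure (P ∩ D k)) {c : ℕ → Set Cantor} (hc : c ∈ OmegaBar) :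
    ∃ x ∈ P, (∀ k, x ∈ D k) ∧ {n | x ∈ c n} ∈ J := by
  refine exists_mem_iInter_of_not_hasBaireProperty hJ hB hP hPn hD hDa hc.1 fun k n p hp => ?_
  obtain ⟨q, hq, hqP, hqD⟩ := mem_closure_iff.1 (hDP k hp) _ (isOpen_cylinder _ p n)
    (self_mem_cylinder p n)
  by_contra! hcon
  refine (hpos _ ((isOpen_cylinder _ p n).inter (hD k)) ⟨q, hqP, hq, hqD⟩).ne'
    (measure_mono_null (fun z hz => ?_) hc.2)
  exact hcon z hz.1 hz.2.1 hz.2.2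

/-! ### Inclusions and non-inclusions between the ideals. -/

theorem limsupMod_subset (hJ : IsIdealOnNat J) (c : ℕ → Set Cantor) :
    limsupMod J c ⊆ {x | {n | x ∈ c n}.Infinite} :=
  fun _ hx hfin => hx (hJ.finite_mem _ hfin)

theorem nullMod_subset_nullIdeal (hJ : IsIdealOnNat J) : nullMod J ⊆ nullIdeal := by
  rintro X ⟨c, hc, hX⟩
  exact measure_mono_null (hX.trans (limsupMod_subset hJ c)) hc.2

theorem closedNullIdeal_subset_nullStarMod (hJ : IsIdealOnNat J) :
    closedNullIdeal ⊆ nullStarMod J := by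
  intro X hX
  obtain ⟨c, hc, hcX⟩ := exists_OmegaBar_eventually hX
  exact ⟨c, hc, fun x hx => hJ.finite_mem _ (hcX x hx)⟩

/-- There is a comeager null set. -/
theorem exists_null_mem_residual : ∃ Z ∈ nullIdeal, Z ∈ residual Cantor := by
  obtain ⟨Q, hQ, hQd⟩ := TopologicalSpace.exists_countable_dense Cantor
  obtain ⟨V, hV, -, hQV, hlt⟩ := exists_antitone_open_superset (hQ.measure_zero lebesgue)
  exact ⟨⋂ n, V n, lebesgue_iInter_eq_zero hlt,
    countable_iInter_mem.2 fun n => residual_of_dense_open (hV n) (hQd.mono (hQV n))⟩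

theorem finite_setOf_le {m : ℕ → ℕ} (hm : StrictMono m) (n : ℕ) : {k | m k ≤ n}.Finite :=
  (Set.finite_le_nat n).subset fun _ hk => hm.le_apply.trans hk

/-- The index of the block of `m` containing `n` (the first block for `n < m 0`). -/
noncomputable def blockIndex (m : ℕ → ℕ) (n : ℕ) : ℕ := sSup {k | m k ≤ n}

theorem blockIndex_eq {m : ℕ → ℕ} (hm : StrictMono m) {k n : ℕ}
    (hn : n ∈ Set.Ico (m k) (m (k + 1))) : blockIndex m n = k := by
  refine IsGreatest.csSup_eq ⟨hn.1, fun l hl => ?_⟩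
  by_contra h
  exact absurd (hn.2.trans_le (hm.monotone (Nat.succ_le_of_lt (not_le.1 h)))) (not_lt.2 hl)

theorem finite_preimage_blockIndex {m : ℕ → ℕ} (hm : StrictMono m) (k : ℕ) :
    {n | blockIndex m n = k}.Finite := by
  refine (Set.finite_lt_nat (m (k + 1))).subset fun n hn => ?_
  by_contra h
  have : k + 1 ≤ blockIndex m n :=
    le_csSup (finite_setOf_le hm n).bddAbove (show m (k + 1) ≤ n from not_lt.1 h)
  have : blockIndex m n = k := hn
  omega

/-- If `J` has the Baire property, then all null sets are null modulo `J`. -/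
theorem nullIdeal_subset_nullMod (hJ : IsIdealOnNat J) (hB : HasBaireProperty J) :
    nullIdeal ⊆ nullMod J := by
  intro X hX
  obtain ⟨m, hm, hmJ⟩ := exists_blocks_of_hasBaireProperty hJ hB
  obtain ⟨c, hc, hcX⟩ := exists_OmegaBar_infinite hX
  refine ⟨fun n => c (blockIndex m n), ⟨fun n => hc.1 _, ?_⟩, fun x hx => ?_⟩
  · refine measure_mono_null (t := {x | {n | x ∈ c n}.Infinite}) (fun x hx hfin => hx ?_) hc.2
    exact (hfin.biUnion fun k _ => finite_preimage_blockIndex hm k).subset fun n hn =>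
      Set.mem_biUnion (x := blockIndex m n) hn rfl
  · refine hmJ _ ((Nat.frequently_atTop_iff_infinite.2 (hcX x hx)).mono fun k hk n hn => ?_)
    show x ∈ c (blockIndex m n)
    rwa [blockIndex_eq hm hn]

/-- If `J` has the Baire property, then `𝒩*_J` is the σ-ideal generated by closed null sets. -/
theorem nullStarMod_subset_closedNullIdeal (hJ : IsIdealOnNat J) (hB : HasBaireProperty J) :
    nullStarMod J ⊆ closedNullIdeal := by
  rintro X ⟨c, hc, hX⟩
  obtain ⟨m, hm, hmJ⟩ := exists_blocks_of_hasBaireProperty hJ hB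
  have hcl : ∀ k, IsClopen (⋃ n ∈ Set.Ico (m k) (m (k + 1)), c n) := fun k =>
    (Set.finite_Ico _ _).isClopen_biUnion fun n _ => hc.1 n
  refine ⟨fun N => ⋂ k ≥ N, ⋃ n ∈ Set.Ico (m k) (m (k + 1)), c n,
    fun N => ⟨isClosed_biInter fun k _ => (hcl k).isClosed, ?_⟩, fun x hx => ?_⟩
  · refine measure_mono_null (fun x hx => ?_) hc.2
    refine Set.infinite_of_not_bddAbove fun ⟨l, hl⟩ => ?_
    have := Set.mem_iInter₂.1 hx (max N (l + 1)) (le_max_left _ _)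
    obtain ⟨n, hn, hxn⟩ := Set.mem_iUnion₂.1 this
    have h1 : n ≤ l := hl hxn
    have h2 := hm.le_apply (x := max N (l + 1))
    have h3 := hn.1
    omega
  · have hfreq : ¬ ∃ᶠ k in atTop, Set.Ico (m k) (m (k + 1)) ⊆ {n | x ∈ c n}ᶜ :=
      fun h => hmJ _ h (hX hx)
    obtain ⟨N, hN⟩ := eventually_atTop.1 (not_frequently.1 hfreq)
    refine Set.mem_iUnion.2 ⟨N, Set.mem_iInter₂.2 fun k hk => ?_⟩
    obtain ⟨n, hn, hxn⟩ := Set.not_subset.1 (hN k hk)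
    exact Set.mem_biUnion hn (not_not.1 hxn)

/-- If `J` does not have the Baire property, then no set that is null modulo `J` is comeager. -/
theorem notMem_residual_of_mem_nullMod (hJ : IsIdealOnNat J) (hB : ¬ HasBaireProperty J)
    {Z : Set Cantor} (hZ : Z ∈ nullMod J) : Z ∉ residual Cantor := by
  intro hres
  obtain ⟨c, hc, hZc⟩ := hZ
  obtain ⟨D, hDo, hDd, hDa, hDZ⟩ := exists_antitone_open_of_mem_residual hres
  obtain ⟨x, -, hxD, hxJ⟩ := exists_mem_iInter_of_selfSupporting hJ hB isClosed_univ
    Set.univ_nonempty (fun U hU hne => by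
      rw [Set.univ_inter] at hne ⊢
      exact hU.measure_pos _ hne) hDo hDa
    (fun k => by rw [Set.univ_inter, (hDd k).closure_eq]) hc
  exact hZc (hDZ (Set.mem_iInter.2 hxD)) hxJ

/-- The witness is a null relatively dense Gδ inside a nowhere dense set of locally positive
measure; fusion inside that set finds a point escaping any given `c`. -/
theorem not_meager_null_subset_nullMod (hJ : IsIdealOnNat J) (hB : ¬ HasBaireProperty J) :
    ¬ (meagerIdeal ∩ nullIdeal ⊆ nullMod J) := by
  intro hsub
  obtain ⟨P, hP, hPn, hPnd, hpos⟩ := exists_nowhereDense_selfSupporting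
  obtain ⟨Q, hQP, hQ, hPQ⟩ :=
    (TopologicalSpace.IsSeparable.of_separableSpace P).exists_countable_dense_subset
  obtain ⟨V, hV, hVa, hQV, hlt⟩ := exists_antitone_open_superset (hQ.measure_zero lebesgue)
  obtain ⟨c, hc, hZc⟩ := hsub (a := P ∩ ⋂ n, V n) ⟨hPnd.isMeagre.mono Set.inter_subset_left,
    measure_mono_null Set.inter_subset_right (lebesgue_iInter_eq_zero hlt)⟩
  obtain ⟨x, hxP, hxV, hxJ⟩ := exists_mem_iInter_of_selfSupporting hJ hB hP hPn hpos hV hVa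
    (fun k => hPQ.trans (closure_mono (Set.subset_inter hQP (hQV k)))) hc
  exact hZc ⟨hxP, Set.mem_iInter.2 hxV⟩ hxJ

/-- The points vanishing on the `n`-th of countably many disjoint blocks, which has length `n`. -/
def zeroBlock (n : ℕ) : Set Cantor :=
  (((Finset.range n).image (Nat.pair n) : Finset ℕ) : Set ℕ).pi fun _ => {false}

theorem mem_zeroBlock {n : ℕ} {x : Cantor} :
    x ∈ zeroBlock n ↔ ∀ i < n, x (Nat.pair n i) = false := by
  simp [zeroBlock, Set.mem_pi]

theorem zeroBlock_mem_OmegaBar : zeroBlock ∈ OmegaBar := by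
  refine mem_OmegaBar_of_tsum (fun n => ?_)
    (ne_top_of_le_ne_top tsum_inv_two_pow_ne_top (ENNReal.tsum_le_tsum fun n => ?_))
  · have : zeroBlock n = ⋂ i ∈ Finset.range n, {x : Cantor | x (Nat.pair n i) = false} := by
      ext x
      simp [mem_zeroBlock]
    rw [this]
    exact isClopen_biInter_finset fun i _ =>
      (isClopen_discrete ({false} : Set Bool)).preimage
        (continuous_apply (A := fun _ => Bool) (Nat.pair n i))
  · rw [zeroBlock, lebesgue_pi_singleton _ fun _ => false, Finset.card_image_of_injective,
      Finset.card_range]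
    exact fun i j h => (Nat.pair_eq_pair.1 h).2

/-- Fusion is applied to the complements of `zeroBlock n`, which need not form a member of
`OmegaBar`; density of the eventually zero sequences replaces the measure argument. -/
theorem not_nullStarMod_subset_meagerIdeal (hJ : IsIdealOnNat J) (hB : ¬ HasBaireProperty J) :
    ¬ (nullStarMod J ⊆ meagerIdeal) := by
  intro hsub
  obtain ⟨D, hDo, hDd, hDa, hDZ⟩ := exists_antitone_open_of_mem_residual
    (hsub ⟨zeroBlock, zeroBlock_mem_OmegaBar, Set.Subset.rfl⟩ : IsMeagre (liminfMod J zeroBlock))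
  obtain ⟨x, -, hxD, hxJ⟩ := exists_mem_iInter_of_not_hasBaireProperty hJ hB isClosed_univ
    Set.univ_nonempty hDo hDa (c := fun n => (zeroBlock n)ᶜ)
    (fun n => (zeroBlock_mem_OmegaBar.1 n).compl) fun k n p _ => by
      obtain ⟨q, hq, hqD⟩ := (hDd k).inter_open_nonempty _ (isOpen_cylinder _ p n)
        ⟨p, self_mem_cylinder p n⟩
      obtain ⟨l, hl⟩ := exists_cylinder_subset ((isOpen_cylinder _ p n).inter (hDo k)) ⟨hq, hqD⟩
      -- Since `j ≤ Nat.pair j i`, a point vanishing from `l` on lies in every `zeroBlock j` with `j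
      -- ≥ l`.
      have hz : (fun i => if i < l then q i else false) ∈ cylinder q l := fun i hi => if_pos hi
      refine ⟨_, trivial, (hl hz).1, (hl hz).2, (Set.finite_lt_nat l).subset fun j hj => ?_⟩
      by_contra hjl
      refine hj (mem_zeroBlock.2 fun i _ => if_neg ?_)
      exact not_lt.2 ((not_lt.1 hjl).trans (Nat.left_le_pair j i))
  exact hDZ (Set.mem_iInter.2 hxD) hxJ

end NullModIdeal

open NullModIdeal
theorem theoremB (J : Set (Set ℕ)) (hJ : IsIdealOnNat J) :
    List.TFAE [
      ¬ HasBaireProperty J,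
      nullMod J ⊂ nullIdeal,
      closedNullIdeal ⊂ nullStarMod J,
      ∀ Z ∈ nullMod J, Z ∉ residual Cantor,
      ¬ (meagerIdeal ∩ nullIdeal ⊆ nullMod J),
      ¬ (nullStarMod J ⊆ meagerIdeal)] := by
  obtain ⟨G, hGnull, hGres⟩ := exists_null_mem_residual
  tfae_have 1 → 2 := fun hB => ⟨nullMod_subset_nullIdeal hJ, fun h =>
    notMem_residual_of_mem_nullMod hJ hB (h hGnull) hGres⟩
  tfae_have 2 → 1 := fun h hB => h.2 (nullIdeal_subset_nullMod hJ hB)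
  tfae_have 1 → 3 := fun hB => ⟨closedNullIdeal_subset_nullStarMod hJ, fun h =>
    not_nullStarMod_subset_meagerIdeal hJ hB (h.trans closedNullIdeal_subset_meagerIdeal)⟩
  tfae_have 3 → 1 := fun h hB => h.2 (nullStarMod_subset_closedNullIdeal hJ hB)
  tfae_have 1 → 4 := fun hB Z hZ => notMem_residual_of_mem_nullMod hJ hB hZ
  tfae_have 4 → 1 := fun h hB => h G (nullIdeal_subset_nullMod hJ hB hGnull) hGres
  tfae_have 1 → 5 := not_meager_null_subset_nullMod hJ
  tfae_have 5 → 1 := fun h hB =>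
    h (Set.inter_subset_right.trans (nullIdeal_subset_nullMod hJ hB))
  tfae_have 1 → 6 := not_nullStarMod_subset_meagerIdeal hJ
  tfae_have 6 → 1 := fun h hB =>
    h ((nullStarMod_subset_closedNullIdeal hJ hB).trans closedNullIdeal_subset_meagerIdeal)
  tfae_finish
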